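/- For integers $q,n\ge 2$ and $1\le d\le n$ let $H_q(n,d)$ denote the graph with vertex set $(\mathbb{Z}/q\mathbb{Z})^n$ in which two vertices $x,y$ are adjacent if and only if their Hamming distance $|\{i : x_i\neq y_i\}|$ is at least $d$. Let $\chi$ denote the chromatic number. A $k$-coloring is a proper vertex coloring with $k$ colors, and it is called even if all its color classes have the same cardinality. (a) $\chi(H_2(n,2))=2^{n-1}$ for all integers $n\ge 2$. (b) Let $q\ge 3$, $n\ge 2$ and let $d$ be an integer with $d>0$ and $n-q+2\le d\le n$. Then $\chi(H_q(n,d))=q^{n-d+1}$, and every $q^{n-d+1}$-coloring of $H_q(n,d)$ is even. -/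

import Mathlib

/-- The Hamming-distance graph `H_q(n,d)`: the vertices are the vectors in `(ℤ/qℤ)^n`, and two
distinct vertices are adjacent iff their Hamming distance is at least `d` (for `d > 0` the
condition `x ≠ y` is redundant). -/
def hammingGraph (q n d : ℕ) : SimpleGraph (Fin n → ZMod q) where
  Adj x y := x ≠ y ∧ d ≤ hammingDist x y
  symm := ⟨fun x y h => ⟨h.1.symm, hammingDist_comm x y ▸ h.2⟩⟩
  loopless := ⟨fun _ h => h.1 rfl⟩

/-- A (proper) coloring is even if all its color classes have the same cardinality. Every color
of the palette `α` counts, so a color that is not used contributes an empty class. -/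
def SimpleGraph.Coloring.IsEven {V α : Type*} {G : SimpleGraph V} (K : G.Coloring α) : Prop :=
  ∀ i j : α, (K.colorClass i).encard = (K.colorClass j).encard

open Polynomial

/-! Color classes are sets of words agreeing pairwise in at least t = n - d + 1 places, and the
first t coordinates give a coloring with q^t colors. So everything rests on |A| ≤ q^(n-t) for such
A: it forces q^t colors and, with exactly q^t, equality in every class. The bound is a weighted
spectral argument. With Q = q - 1, sum over coordinate sets S the positive semidefinite kernels ∏_{i
∈ S} `agreementKernel`, with weights b_|S| ≥ 0 and b_0 = 1. The entry at words with a agreements and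
e disagreements is L((1 + QX)^a (1 - X)^e), where L sends X^w to b_w. The weights are chosen so that
it vanishes for a ≥ t, e > 0 and is q^(n-t) on the diagonal. Keeping only S = ∅ gives |A|² ≤ |A|
q^(n-t). -/

/-- The linear functional on real polynomials that sends `X ^ w` to `b w`. -/
noncomputable def momentFunctional (b : ℕ → ℝ) : ℝ[X] →ₗ[ℝ] ℝ :=
  Polynomial.lsum fun w => b w • LinearMap.id

theorem momentFunctional_monomial (b : ℕ → ℝ) (w : ℕ) (r : ℝ) :
    momentFunctional b (monomial w r) = b w * r := by
  simp [momentFunctional, Polynomial.lsum_apply, Polynomial.sum_monomial_index]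

theorem momentFunctional_one_add_mul (b : ℕ → ℝ) (c : ℝ) (p : ℝ[X]) :
    momentFunctional b ((1 + C c * X) * p) =
      momentFunctional (fun w => b w + c * b (w + 1)) p := by
  induction p using Polynomial.induction_on' with
  | add p q hp hq => rw [mul_add, map_add, map_add, hp, hq]
  | monomial w r =>
    have : (1 + C c * X) * monomial w r = monomial w r + monomial (w + 1) (c * r) := by
      rw [add_mul, one_mul, mul_assoc, X_mul_monomial, C_mul_monomial]
    rw [this, map_add]
    simp only [momentFunctional_monomial]
    ring

theorem momentFunctional_smul (b : ℕ → ℝ) (c : ℝ) (p : ℝ[X]) :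
    momentFunctional (fun w => c * b w) p = c * momentFunctional b p := by
  induction p using Polynomial.induction_on' with
  | add p q hp hq => rw [map_add, map_add, hp, hq, mul_add]
  | monomial w r => simp only [momentFunctional_monomial, mul_assoc]

/-! ### Spectral weights -/

/-- The binomial coefficient `(w - 1).choose (t - 1)`, extended to `w = 0` by Pascal's rule,
and vanishing for `t = 0`. -/
def predChoose : ℕ → ℕ → ℤ
  | 0, _ => 0
  | t + 1, 0 => (-1) ^ t
  | t + 1, w + 1 => w.choose t

theorem predChoose_pascal (t w : ℕ) :
    predChoose (t + 1) (w + 1) = predChoose (t + 1) w + predChoose t w := by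
  rcases t with _ | t <;> rcases w with _ | w <;> simp [predChoose, Nat.choose_succ_succ, pow_succ]
  ring

theorem predChoose_succ_nonneg (t w : ℕ) : 0 ≤ predChoose t (w + 1) := by
  cases t <;> simp [predChoose]

/-- The increments, up to sign, of the spectral weights. -/
noncomputable def weightStep (Q : ℝ) (t w : ℕ) : ℝ := (-1) ^ w * predChoose t w / Q ^ w

/-- The spectral weights: the partial sums of a binomial series. -/
noncomputable def spectralWeight (Q : ℝ) (t w : ℕ) : ℝ :=
  1 + (-1) ^ t * ∑ k ∈ Finset.range w, weightStep Q t k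

theorem spectralWeight_zero (Q : ℝ) (t : ℕ) : spectralWeight Q t 0 = 1 := by
  simp [spectralWeight]

theorem spectralWeight_succ (Q : ℝ) (t w : ℕ) :
    spectralWeight Q t (w + 1) = spectralWeight Q t w + (-1) ^ t * weightStep Q t w := by
  simp only [spectralWeight, Finset.sum_range_succ]
  ring

theorem spectralWeight_one (Q : ℝ) (t : ℕ) : spectralWeight Q (t + 1) 1 = 0 := by
  rw [spectralWeight_succ, spectralWeight_zero]
  simp [weightStep, predChoose, pow_succ, ← mul_pow]

theorem spectralWeight_eq_zero (Q : ℝ) {t w : ℕ} (hw : 1 ≤ w) (hwt : w ≤ t) :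
    spectralWeight Q t w = 0 := by
  obtain ⟨t, rfl⟩ : ∃ s, t = s + 1 := ⟨t - 1, by omega⟩
  induction w, hw using Nat.le_induction with
  | base => exact spectralWeight_one Q t
  | succ w hw ih =>
    obtain ⟨v, rfl⟩ : ∃ v, w = v + 1 := ⟨w - 1, by omega⟩
    rw [spectralWeight_succ, ih (by omega)]
    simp [weightStep, predChoose, Nat.choose_eq_zero_of_lt (show v < t by omega)]

/-- The increments are (-1/Q)^w times a polynomial in w of degree below t. By Pascal's rule, each
factor 1 + QX, acting as 1 + Q·shift, lowers t by one up to sign. -/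
theorem momentFunctional_weightStep {Q : ℝ} (hQ : Q ≠ 0) (t : ℕ) (p : ℝ[X]) :
    momentFunctional (weightStep Q t) ((1 + C Q * X) ^ t * p) = 0 := by
  induction t generalizing p with
  | zero =>
    have : weightStep Q 0 = fun w => 0 * (0 : ℝ) := by
      funext w; simp [weightStep, predChoose]
    rw [this, momentFunctional_smul, zero_mul]
  | succ t ih =>
    have : (fun w => weightStep Q (t + 1) w + Q * weightStep Q (t + 1) (w + 1)) =
        fun w => -1 * weightStep Q t w := by
      funext w
      simp only [weightStep, predChoose_pascal]
      push_cast
      field_simp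
      ring
    rw [pow_succ', mul_assoc, momentFunctional_one_add_mul, this, momentFunctional_smul, ih,
      mul_zero]

theorem momentFunctional_spectralWeight_of_pos {Q : ℝ} (hQ : Q ≠ 0) {t a e : ℕ} (hta : t ≤ a)
    (he : 0 < e) :
    momentFunctional (spectralWeight Q t) ((1 + C Q * X) ^ a * (1 + C (-1) * X) ^ e) = 0 := by
  obtain ⟨e, rfl⟩ : ∃ s, e = s + 1 := ⟨e - 1, by omega⟩
  obtain ⟨a, rfl⟩ := Nat.exists_eq_add_of_le hta
  have h : (fun w => spectralWeight Q t w + -1 * spectralWeight Q t (w + 1)) =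
      fun w => -(-1) ^ t * weightStep Q t w := by
    funext w
    rw [spectralWeight_succ]
    ring
  rw [pow_succ', mul_left_comm, momentFunctional_one_add_mul, h, momentFunctional_smul, pow_add,
    mul_assoc, momentFunctional_weightStep hQ, mul_zero]

theorem momentFunctional_spectralWeight_pow {Q : ℝ} (hQ : Q ≠ 0) {t n : ℕ} (htn : t ≤ n) :
    momentFunctional (spectralWeight Q t) ((1 + C Q * X) ^ n) = (Q + 1) ^ (n - t) := by
  induction n, htn using Nat.le_induction with
  | base =>
    rw [Nat.sub_self, pow_zero]
    have h : (1 + C Q * X : ℝ[X]) ^ t =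
        ∑ w ∈ Finset.range (t + 1), monomial w (Q ^ w * (t.choose w : ℝ)) := by
      rw [add_comm, add_pow]
      refine Finset.sum_congr rfl fun w _ => ?_
      rw [one_pow, mul_one, mul_pow, ← C_pow, ← C_mul_X_pow_eq_monomial, C_mul, C_eq_natCast]
      ring
    rw [h, map_sum, Finset.sum_range_succ', Finset.sum_eq_zero]
    · rw [zero_add, momentFunctional_monomial, spectralWeight_zero]
      simp
    · intro w hw
      rw [Finset.mem_range] at hw
      rw [momentFunctional_monomial, spectralWeight_eq_zero Q (by omega) (by omega), zero_mul]
  | succ n htn ih =>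
    -- Since 1 + QX = (Q + 1) - Q(1 - X) and L kills the second term, each factor beyond t
    -- contributes Q + 1.
    have h : (1 + C Q * X : ℝ[X]) ^ (n + 1) =
        (Q + 1) • (1 + C Q * X) ^ n - Q • ((1 + C Q * X) ^ n * (1 + C (-1) * X) ^ 1) := by
      simp only [smul_eq_C_mul, C_add, C_1, C_neg]
      ring
    rw [h, map_sub, map_smul, map_smul, ih, momentFunctional_spectralWeight_of_pos hQ htn one_pos,
      Nat.sub_add_comm htn, pow_succ]
    simp [mul_comm]

/-- The ratio of consecutive terms is w / ((w - t + 1)Q), largest at w = t; this is where t ≤ Q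
enters. -/
theorem predChoose_div_pow_antitone {Q : ℝ} {t w : ℕ} (hQ : (t : ℝ) ≤ Q) (ht : 0 < t)
    (hw : t ≤ w) :
    predChoose t (w + 1) / Q ^ (w + 1) ≤ predChoose t w / Q ^ w := by
  obtain ⟨t, rfl⟩ : ∃ s, t = s + 1 := ⟨t - 1, by omega⟩
  obtain ⟨m, rfl⟩ := Nat.exists_eq_add_of_le hw
  have hQ0 : 0 < Q := lt_of_lt_of_le (by positivity) hQ
  have e : t + 1 + m = (t + m) + 1 := by omega
  rw [e]
  simp only [predChoose]
  have h := Nat.choose_mul_succ_eq (t + m) t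
  rw [show t + m + 1 - t = m + 1 by omega] at h
  have h' : ((t + m).choose t : ℝ) * (t + m + 1) = (t + m + 1).choose t * (m + 1) := by
    exact_mod_cast h
  have hm : (t + m + 1 : ℝ) ≤ Q * (m + 1) := by
    push_cast at hQ
    nlinarith [mul_nonneg (Nat.cast_nonneg (α := ℝ) t) (Nat.cast_nonneg (α := ℝ) m),
      mul_le_mul_of_nonneg_right hQ (Nat.cast_nonneg (α := ℝ) m)]
  have key : ((t + m + 1).choose t : ℝ) ≤ (t + m).choose t * Q := by
    refine le_of_mul_le_mul_right ?_ (show (0 : ℝ) < m + 1 by positivity)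
    rw [← h', mul_assoc]
    exact mul_le_mul_of_nonneg_left hm (Nat.cast_nonneg _)
  rw [pow_succ Q (t + m + 1), div_le_div_iff₀ (by positivity) (by positivity)]
  push_cast
  calc ((t + m + 1).choose t : ℝ) * Q ^ (t + m + 1)
      ≤ (t + m).choose t * Q * Q ^ (t + m + 1) := by gcongr
    _ = (t + m).choose t * (Q ^ (t + m + 1) * Q) := by ring

theorem spectralWeight_nonneg {Q : ℝ} {t : ℕ} (hQ : (t : ℝ) ≤ Q) (ht : 0 < t) (w : ℕ) :
    0 ≤ spectralWeight Q t w := by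
  have hQ0 : 0 < Q := lt_of_lt_of_le (by positivity) hQ
  rcases Nat.eq_zero_or_pos w with rfl | hw
  · simp [spectralWeight_zero]
  -- Alternating series: when the next increment is negative, the weight must already dominate it.
  suffices h : (Even (t + w) → 0 ≤ spectralWeight Q t w) ∧
      (Odd (t + w) → predChoose t w / Q ^ w ≤ spectralWeight Q t w) by
    rcases Nat.even_or_odd (t + w) with he | ho
    · exact h.1 he
    · refine le_trans ?_ (h.2 ho)
      obtain ⟨v, rfl⟩ : ∃ v, w = v + 1 := ⟨w - 1, by omega⟩
      have := predChoose_succ_nonneg t v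
      positivity
  induction w, hw using Nat.le_induction with
  | base =>
    rw [spectralWeight_eq_zero Q le_rfl ht]
    refine ⟨fun _ => le_rfl, fun ho => ?_⟩
    obtain ⟨t, rfl⟩ : ∃ s, t = s + 2 := ⟨t - 2, by
      rcases ho with ⟨k, hk⟩; omega⟩
    simp [predChoose]
  | succ w hw ih =>
    have hstep : spectralWeight Q t (w + 1) =
        spectralWeight Q t w + (-1) ^ (t + w) * (predChoose t w / Q ^ w) := by
      rw [spectralWeight_succ, weightStep, pow_add]
      ring
    refine ⟨fun he => ?_, fun ho => ?_⟩
    · have ho : Odd (t + w) := by rw [← Nat.not_even_iff_odd]; rw [← add_assoc] at he; grind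
      rw [hstep, ho.neg_one_pow]
      linarith [ih.2 ho]
    · have he : Even (t + w) := by rw [← add_assoc] at ho; grind
      rcases le_or_gt t w with htw | htw
      · rw [hstep, he.neg_one_pow]
        linarith [ih.1 he, predChoose_div_pow_antitone hQ ht htw]
      · have h1 : w + 1 < t := by
          by_contra h
          have : w + 1 = t := by omega
          subst this
          grind
        obtain ⟨t, rfl⟩ : ∃ s, t = s + 1 := ⟨t - 1, by omega⟩
        rw [spectralWeight_eq_zero Q (by omega) (by omega)]
        simp [predChoose, Nat.choose_eq_zero_of_lt (show w < t by omega)]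

/-! ### Positive semidefinite kernels and intersecting families -/

section Kernel

variable {ι α : Type*} [DecidableEq α]

/-- The kernel with value `q - 1` on the diagonal and `-1` off it, where `q` is the size of the
alphabet. -/
def agreementKernel [Fintype α] (u v : α) : ℝ := if u = v then (Fintype.card α : ℝ) - 1 else -1

variable [Fintype α]

theorem agreementKernel_eq_sum [Nonempty α] (u v : α) :
    agreementKernel u v =
      ∑ c, (Fintype.card α : ℝ)⁻¹ * (agreementKernel c u * agreementKernel c v) := by
  have h (u v : α) : agreementKernel u v = (Fintype.card α : ℝ) * (if u = v then 1 else 0) - 1 := by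
    unfold agreementKernel; split_ifs <;> ring
  rw [← Finset.mul_sum]
  simp only [h, sub_mul, mul_sub, Finset.sum_sub_distrib, mul_one, one_mul, ite_mul, mul_ite,
    mul_zero, zero_mul, Finset.sum_ite_eq', Finset.mem_univ, if_true]
  simp [eq_comm]

/-- The kernel is an average of rank-one kernels indexed by letters c. Peeling off one coordinate
absorbs their factors into `f`, hence the arbitrary `f`. -/
theorem prod_agreementKernel_nonneg [Nonempty α] (A : Finset (ι → α)) (S : Finset ι)
    (f : (ι → α) → ℝ) :
    0 ≤ ∑ x ∈ A, ∑ y ∈ A, f x * f y * ∏ i ∈ S, agreementKernel (x i) (y i) := by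
  classical
  induction S using Finset.induction_on generalizing f with
  | empty =>
    simp only [Finset.prod_empty, mul_one, ← Finset.mul_sum, ← Finset.sum_mul]
    exact mul_self_nonneg _
  | insert j S hj ih =>
    have h : ∑ x ∈ A, ∑ y ∈ A, f x * f y * ∏ i ∈ insert j S, agreementKernel (x i) (y i) =
        ∑ c, (Fintype.card α : ℝ)⁻¹ * ∑ x ∈ A, ∑ y ∈ A,
          (f x * agreementKernel c (x j)) * (f y * agreementKernel c (y j)) *
            ∏ i ∈ S, agreementKernel (x i) (y i) := by
      simp only [Finset.prod_insert hj, Finset.mul_sum]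
      rw [Finset.sum_comm (s := Finset.univ)]
      refine Finset.sum_congr rfl fun x _ => ?_
      rw [Finset.sum_comm (s := Finset.univ)]
      refine Finset.sum_congr rfl fun y _ => ?_
      rw [agreementKernel_eq_sum (x j), Finset.sum_mul, Finset.mul_sum]
      refine Finset.sum_congr rfl fun c _ => ?_
      ring
    rw [h]
    exact Finset.sum_nonneg fun c _ => mul_nonneg (by positivity) (ih _)

variable [Fintype ι]

theorem prod_one_add_agreementKernel (x y : ι → α) :
    ∏ i, (1 + C (agreementKernel (x i) (y i)) * X : ℝ[X]) =
      (1 + C ((Fintype.card α : ℝ) - 1) * X) ^ (Fintype.card ι - hammingDist x y) *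
        (1 + C (-1) * X) ^ hammingDist x y := by
  have h : (Finset.univ.filter fun i => x i = y i).card =
      Fintype.card ι - hammingDist x y := by
    rw [hammingDist, ← Finset.card_univ,
      ← Finset.card_filter_add_card_filter_not (s := Finset.univ) (fun i => x i = y i)]
    simp
  rw [← h, hammingDist, ← Finset.prod_filter_mul_prod_filter_not Finset.univ (fun i => x i = y i)]
  congr 1 <;>
  · refine Finset.prod_eq_pow_card fun i hi => ?_
    rw [Finset.mem_filter] at hi
    simp [agreementKernel, hi.2]

theorem sum_spectralWeight_eq (b : ℕ → ℝ) (x y : ι → α) :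
    ∑ S : Finset ι, b S.card * ∏ i ∈ S, agreementKernel (x i) (y i) =
      momentFunctional b (∏ i, (1 + C (agreementKernel (x i) (y i)) * X : ℝ[X])) := by
  rw [Finset.prod_one_add, map_sum, Finset.powerset_univ]
  refine Finset.sum_congr rfl fun S _ => ?_
  rw [Finset.prod_mul_distrib, Finset.prod_const, ← map_prod, C_mul_X_pow_eq_monomial,
    momentFunctional_monomial]

/-- An Erdős–Ko–Rado bound for integer sequences: if any two members of `A` agree in at
least `t` places and the alphabet has more than `t` letters, then `A` is at most as large as the
family of all sequences with `t` prescribed entries. -/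
theorem card_le_of_hammingDist_le (A : Finset (ι → α)) {t : ℕ} (ht : 0 < t)
    (hq : t + 1 ≤ Fintype.card α) (htn : t ≤ Fintype.card ι)
    (hA : ∀ x ∈ A, ∀ y ∈ A, hammingDist x y + t ≤ Fintype.card ι) :
    A.card ≤ Fintype.card α ^ (Fintype.card ι - t) := by
  have : Nonempty α := Fintype.card_pos_iff.1 (by omega)
  set Q : ℝ := (Fintype.card α : ℝ) - 1 with hQdef
  have hQ : (t : ℝ) ≤ Q := by
    have : ((t + 1 : ℕ) : ℝ) ≤ Fintype.card α := by exact_mod_cast hq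
    push_cast at this
    linarith
  have hQ0 : Q ≠ 0 := (lt_of_lt_of_le (by positivity) hQ).ne'
  have hupper : ∑ x ∈ A, ∑ y ∈ A, ∑ S : Finset ι,
      spectralWeight Q t S.card * ∏ i ∈ S, agreementKernel (x i) (y i) =
        A.card * (Q + 1) ^ (Fintype.card ι - t) := by
    rw [← nsmul_eq_mul]
    refine Finset.sum_eq_card_nsmul fun x hx => ?_
    rw [Finset.sum_eq_single_of_mem x hx]
    · rw [sum_spectralWeight_eq, prod_one_add_agreementKernel, hammingDist_self, pow_zero, mul_one,
        Nat.sub_zero, momentFunctional_spectralWeight_pow hQ0 htn]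
    · intro y hy hne
      have hd := hA x hx y hy
      rw [sum_spectralWeight_eq, prod_one_add_agreementKernel,
        momentFunctional_spectralWeight_of_pos hQ0 (by omega) (hammingDist_pos.2 hne.symm)]
  have hlower : (A.card : ℝ) * A.card ≤ ∑ x ∈ A, ∑ y ∈ A, ∑ S : Finset ι,
      spectralWeight Q t S.card * ∏ i ∈ S, agreementKernel (x i) (y i) := by
    have hswap : ∑ x ∈ A, ∑ y ∈ A, ∑ S : Finset ι,
        spectralWeight Q t S.card * ∏ i ∈ S, agreementKernel (x i) (y i) =
          ∑ S : Finset ι, spectralWeight Q t S.card *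
            ∑ x ∈ A, ∑ y ∈ A, ∏ i ∈ S, agreementKernel (x i) (y i) := by
      simp only [Finset.mul_sum]
      rw [Finset.sum_comm (s := Finset.univ)]
      refine Finset.sum_congr rfl fun x _ => ?_
      rw [Finset.sum_comm]
    rw [hswap]
    refine le_trans (le_of_eq ?_) (Finset.single_le_sum (fun S _ => ?_) (Finset.mem_univ ∅))
    · simp [spectralWeight_zero]
    · refine mul_nonneg (spectralWeight_nonneg hQ ht _) ?_
      simpa using prod_agreementKernel_nonneg A S fun _ => 1
  rw [hupper] at hlower
  rcases A.eq_empty_or_nonempty with rfl | hne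
  · simp
  have hpos : (0 : ℝ) < A.card := by exact_mod_cast hne.card_pos
  have := le_of_mul_le_mul_left hlower hpos
  rw [hQdef, sub_add_cancel] at this
  exact_mod_cast this

end Kernel

/-! ### Colorings -/

/-- In a set of pairwise Hamming distance at most one, the coordinate sum is injective. -/
theorem card_le_of_hammingDist_le_one {q n : ℕ} [NeZero q] (A : Finset (Fin n → ZMod q))
    (hA : ∀ x ∈ A, ∀ y ∈ A, hammingDist x y ≤ 1) : A.card ≤ q := by
  have h : Set.InjOn (fun x : Fin n → ZMod q => ∑ i, x i) A := by
    intro x hx y hy hxy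
    by_contra hne
    obtain ⟨i, hi⟩ := Function.ne_iff.1 hne
    have hd := hA x hx y hy
    rw [hammingDist, Finset.card_le_one] at hd
    have hother : ∀ j ∈ Finset.univ.erase i, x j = y j := by
      intro j hj
      by_contra hjne
      exact (Finset.ne_of_mem_erase hj) (hd j (by simpa using hjne) i (by simpa using hi))
    simp only at hxy
    rw [← Finset.add_sum_erase _ x (Finset.mem_univ i),
      ← Finset.add_sum_erase _ y (Finset.mem_univ i), Finset.sum_congr rfl hother] at hxy
    exact hi (add_right_cancel hxy)
  simpa using Finset.card_le_card_of_injOn _ (fun x _ => Finset.mem_univ _) h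

theorem hammingGraph_colorable {q n d t : ℕ} [NeZero q] (h : n < d + t) (ht : t ≤ n) :
    (hammingGraph q n d).Colorable (q ^ t) := by
  let K : (hammingGraph q n d).Coloring (Fin t → ZMod q) :=
    SimpleGraph.Coloring.mk (fun x i => x (Fin.castLE ht i)) (by
      intro x y hxy heq
      have hd : d ≤ hammingDist x y := hxy.2
      have hsub : (Finset.univ.filter fun i => x i ≠ y i) ⊆
          Finset.univ \ Finset.univ.map (Fin.castLEEmb ht) := by
        intro i hi
        simp only [Finset.mem_sdiff, Finset.mem_univ, true_and, Finset.mem_map, not_exists]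
        rintro j rfl
        exact (Finset.mem_filter.1 hi).2 (congrFun heq j)
      have hle := Finset.card_le_card hsub
      rw [Finset.card_sdiff_of_subset (Finset.subset_univ _)] at hle
      simp only [Finset.card_univ, Fintype.card_fin, Finset.card_map] at hle
      rw [hammingDist] at hd
      omega)
  simpa using K.colorable

theorem hammingDist_lt_of_coloring_eq {q n d : ℕ} (hd : 0 < d) {β : Type*}
    (K : (hammingGraph q n d).Coloring β) {x y : Fin n → ZMod q} (h : K x = K y) :
    hammingDist x y < d := by
  by_contra hlt
  refine K.valid (v := x) (w := y) ⟨?_, by omega⟩ h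
  rintro rfl
  simp at hlt
  omega

/-- If the independent sets of a finite graph have at most `M` elements and the graph has `k * M`
vertices, then it cannot be colored with fewer than `k` colors. -/
theorem SimpleGraph.le_of_coloring_of_card_le {V : Type*} [Fintype V] {G : SimpleGraph V}
    {k m M : ℕ} (hM : 0 < M) (hV : Fintype.card V = k * M) (K : G.Coloring (Fin m))
    (hK : ∀ i, (Finset.univ.filter fun x => K x = i).card ≤ M) : k ≤ m := by
  have h := Finset.card_le_mul_card_image_of_maps_to (s := (Finset.univ : Finset V))
    (t := (Finset.univ : Finset (Fin m))) (f := K) (fun _ _ => Finset.mem_univ _) M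
    (fun i _ => hK i)
  rw [Finset.card_univ, Finset.card_univ, Fintype.card_fin, hV, mul_comm] at h
  exact Nat.le_of_mul_le_mul_left h hM

theorem SimpleGraph.Coloring.isEven_of_card_le {V : Type*} [Fintype V] {G : SimpleGraph V}
    {k M : ℕ} (hV : Fintype.card V = k * M) (K : G.Coloring (Fin k))
    (hK : ∀ i, (Finset.univ.filter fun x => K x = i).card ≤ M) : K.IsEven := by
  have hsum : ∑ i, (Finset.univ.filter fun x => K x = i).card = ∑ _i : Fin k, M := by
    rw [← Finset.card_eq_sum_card_fiberwise (fun _ _ => Finset.mem_univ _)]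
    simp [hV]
  have heq := (Finset.sum_eq_sum_iff_of_le fun i _ => hK i).1 hsum
  have hclass (i : Fin k) : (K.colorClass i).encard = M := by
    rw [← heq i (Finset.mem_univ i), ← Set.encard_coe_eq_coe_finsetCard]
    congr 1
    ext x
    simp [SimpleGraph.Coloring.colorClass]
  intro i j
  rw [hclass, hclass]

theorem hammingGraph_chromaticNumber {q n d t M : ℕ} [NeZero q] (h : n < d + t) (ht : t ≤ n)
    (hM : M = q ^ (n - t))
    (hcard : ∀ (m : ℕ) (K : (hammingGraph q n d).Coloring (Fin m)) (i : Fin m),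
      (Finset.univ.filter fun x => K x = i).card ≤ M) :
    (hammingGraph q n d).chromaticNumber = ((q ^ t : ℕ) : ℕ∞) := by
  refine le_antisymm (hammingGraph_colorable h ht).chromaticNumber_le ?_
  rw [SimpleGraph.le_chromaticNumber_iff_coloring]
  intro m K
  refine SimpleGraph.le_of_coloring_of_card_le (M := M) ?_ ?_ K (hcard m K)
  · rw [hM]
    exact pow_pos (NeZero.pos q) _
  · rw [hM, ← pow_add, Nat.add_sub_cancel' ht]
    simp

theorem mainTheorem6 :
    (∀ n : ℕ, 2 ≤ n →
      (hammingGraph 2 n 2).chromaticNumber = ((2 ^ (n - 1) : ℕ) : ℕ∞)) ∧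
    (∀ q n d : ℕ, 3 ≤ q → 2 ≤ n → 0 < d → (n : ℤ) - (q : ℤ) + 2 ≤ (d : ℤ) → d ≤ n →
      (hammingGraph q n d).chromaticNumber = ((q ^ (n - d + 1) : ℕ) : ℕ∞) ∧
      ∀ K : (hammingGraph q n d).Coloring (Fin (q ^ (n - d + 1))), K.IsEven) := by
  constructor
  · intro n hn
    -- Here t = n - 1, so t < q fails for n > 2, and the elementary bound for diameter one replaces
    -- the spectral one.
    refine hammingGraph_chromaticNumber (M := 2) (by omega) (by omega)
      (by rw [Nat.sub_sub_self (by omega), pow_one]) fun m K i => ?_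
    refine card_le_of_hammingDist_le_one _ fun x hx y hy => ?_
    rw [Finset.mem_filter] at hx hy
    have := hammingDist_lt_of_coloring_eq two_pos K (hx.2.trans hy.2.symm)
    omega
  · intro q n d hq hn hd hqd hdn
    have : NeZero q := ⟨by omega⟩
    have hcard (m : ℕ) (K : (hammingGraph q n d).Coloring (Fin m)) (i : Fin m) :
        (Finset.univ.filter fun x => K x = i).card ≤ q ^ (n - (n - d + 1)) := by
      have h := card_le_of_hammingDist_le (Finset.univ.filter fun x => K x = i) (t := n - d + 1)
        (by omega) (by rw [ZMod.card]; omega) (by rw [Fintype.card_fin]; omega) ?_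
      · simpa using h
      intro x hx y hy
      rw [Finset.mem_filter] at hx hy
      have := hammingDist_lt_of_coloring_eq hd K (hx.2.trans hy.2.symm)
      rw [Fintype.card_fin]
      omega
    refine ⟨hammingGraph_chromaticNumber (by omega) (by omega) rfl hcard, fun K => ?_⟩
    refine SimpleGraph.Coloring.isEven_of_card_le ?_ K (hcard _ K)
    rw [← pow_add, Nat.add_sub_cancel' (by omega)]
    simp
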